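/- Let $k\ge 2$ be an integer and let $\alpha,\beta\in\mathbb C$ satisfy $|\alpha|^k<|\beta|\le|\alpha|^{k-1}$. Consider the automorphisms of $\mathbb C^2$ $$F(z_1,z_2)=(\alpha z_1+z_2^2,\ \beta z_2)\quad\text{and}\quad G(z_1,z_2)=(\beta z_1,\ \alpha z_2+z_1^k).$$ Let $\{F_n\}_{n\ge 1}$ be any sequence in which each $F_n$ is either $F$ or $G$. Then the non-autonomous basin of attraction of $\{F_n\}$ at the origin, $$\Omega_{\{F_n\}}=\{z\in\mathbb C^2:\ F_n\circ F_{n-1}\circ\cdots\circ F_1(z)\to 0\ \text{as}\ n\to\infty\},$$ is an open subset of $\mathbb C^2$ that is biholomorphic to $\mathbb C^2$. -/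

import Mathlib

open Filter Topology

/-- The map `F(z₁, z₂) = (α z₁ + z₂², β z₂)` of `ℂ²`. -/
def mapF (α β : ℂ) (z : ℂ × ℂ) : ℂ × ℂ := (α * z.1 + z.2 ^ 2, β * z.2)

/-- The map `G(z₁, z₂) = (β z₁, α z₂ + z₁ᵏ)` of `ℂ²`. -/
def mapG (α β : ℂ) (k : ℕ) (z : ℂ × ℂ) : ℂ × ℂ := (β * z.1, α * z.2 + z.1 ^ k)

/-- The composition of the first `n` maps of a sequence, the map `f 0` being applied first:
`nonautComp f n = f (n - 1) ∘ ⋯ ∘ f 1 ∘ f 0`, and `nonautComp f 0 = id`. -/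
def nonautComp {X : Type*} (f : ℕ → X → X) : ℕ → X → X
  | 0 => id
  | n + 1 => f n ∘ nonautComp f n

/-- The non-autonomous basin of attraction of the sequence `f` at the point `p`: the points
`z` such that `f (n - 1) ∘ ⋯ ∘ f 0` maps `z` to a sequence of points that tends to `p`. -/
def nonautBasin {X : Type*} [TopologicalSpace X] (f : ℕ → X → X) (p : X) : Set X :=
  {z | Tendsto (fun n => nonautComp f n z) atTop (𝓝 p)}

/-- `U` and `V` are open sets, and there is a holomorphic bijection of `U` onto `V` with
holomorphic inverse. -/
def Biholomorphic {E E' : Type*} [NormedAddCommGroup E] [NormedSpace ℂ E]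
    [NormedAddCommGroup E'] [NormedSpace ℂ E'] (U : Set E) (V : Set E') : Prop :=
  IsOpen U ∧ IsOpen V ∧ ∃ (φ : E → E') (ψ : E' → E),
    DifferentiableOn ℂ φ U ∧ DifferentiableOn ℂ ψ V ∧
    Set.MapsTo φ U V ∧ Set.MapsTo ψ V U ∧ Set.InvOn ψ φ U V

/-! ### Limits of holomorphic sequences with summable increments. -/

section UniformLimits

open Metric

/-! Both maps are a triangular map `t_n` after a shear `σ_n` (trivial for `F`). With `T_n = t_{n-1}
∘ ⋯ ∘ t_0` and `H_n = T_n⁻¹ ∘ σ_n ∘ T_n`, the `n`-fold composition is `T_n ∘ H_{n-1} ∘ ⋯ ∘ H_0`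
(`nonautComp_eq_triComp`). On bounded sets `T_n = O(|α|^n)`, and undoing `T_n` costs at most about
`|β|^{-n}`. Hence `H_n - id = O((|α|^k/|β|)^n)`, which is summable (`TriBounds.summablyNearId`). The
infinite composition of the `H_n` then maps the points with bounded `H`-orbit biholomorphically onto
the whole space (`biholomorphic_boundedOrbits`). These points form the basin
(`nonautBasin_eq_boundedOrbits`): `T_n` contracts bounded orbits to the origin; conversely an orbit
tending to the origin decays fast enough to make the increments of its `H`-orbit summable. -/

theorem tendstoUniformlyOn_of_norm_succ_sub_le {X F : Type*} [NormedAddCommGroup F]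
    {f : ℕ → X → F} {g : X → F} {U : Set X} {u : ℕ → ℝ} (hu : Summable u)
    (hf : ∀ n, ∀ x ∈ U, ‖f (n + 1) x - f n x‖ ≤ u n)
    (hg : ∀ x ∈ U, Tendsto (fun n => f n x) atTop (𝓝 (g x))) :
    TendstoUniformlyOn f g atTop U := by
  rw [Metric.tendstoUniformlyOn_iff]
  intro ε hε
  have htail := tendsto_sum_nat_add u
  filter_upwards [htail.eventually_lt_const hε] with n hn x hx
  have h := dist_le_tsum_of_dist_le_of_tendsto (f := fun n => f n x) u
    (fun m => by rw [dist_comm, dist_eq_norm]; exact hf m x hx) hu (hg x hx) n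
  rw [dist_comm]
  refine h.trans_lt ?_
  simpa only [add_comm n] using hn

theorem exists_tendsto_of_norm_succ_sub_le {X F : Type*} [NormedAddCommGroup F] [CompleteSpace F]
    {f : ℕ → X → F} {U : Set X} {u : ℕ → ℝ} (hu : Summable u)
    (hf : ∀ n, ∀ x ∈ U, ‖f (n + 1) x - f n x‖ ≤ u n) {x : X} (hx : x ∈ U) :
    ∃ y, Tendsto (fun n => f n x) atTop (𝓝 y) :=
  cauchySeq_tendsto_of_complete <| cauchySeq_of_dist_le_of_summable u
    (fun n => by rw [dist_comm, dist_eq_norm]; exact hf n x hx) hu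

/-- A telescoping sequence of holomorphic maps with summable increments on an open set has a
holomorphic limit. -/
theorem differentiableOn_of_norm_succ_sub_le {E F : Type*} [NormedAddCommGroup E]
    [NormedSpace ℂ E] [NormedAddCommGroup F] [NormedSpace ℂ F] [CompleteSpace F]
    {f : ℕ → E → F} {g : E → F} {U : Set E} (hU : IsOpen U) {u : ℕ → ℝ} (hu : Summable u)
    (hd : ∀ n, Differentiable ℂ (f n))
    (hf : ∀ n, ∀ x ∈ U, ‖f (n + 1) x - f n x‖ ≤ u n)
    (hg : ∀ x ∈ U, Tendsto (fun n => f n x) atTop (𝓝 (g x))) :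
    DifferentiableOn ℂ g U := by
  intro x hx
  obtain ⟨r, hr, hrU⟩ := Metric.isOpen_iff.1 hU x hx
  have hr2 : 0 < r / 2 := half_pos hr
  have hsub : ∀ y ∈ ball x (r / 2), ball y (r / 2) ⊆ U := fun y hy z hz => hrU <| by
    have := dist_triangle z y x
    simp only [mem_ball] at *
    linarith
  -- Cauchy's estimate makes the increments of the derivatives summable, so the derivatives converge
  -- uniformly near `x`.
  have hder : ∀ n, ∀ y ∈ ball x (r / 2),
      ‖fderiv ℂ (f (n + 1)) y - fderiv ℂ (f n) y‖ ≤ 2 * u n / (r / 2) := by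
    intro n y hy
    rw [← fderiv_sub (hd _ _) (hd _ _)]
    refine Complex.norm_fderiv_le_div_of_mapsTo_ball
      ((hd _).sub (hd _)).differentiableOn (fun z hz => ?_) hr2
    rw [mem_closedBall, dist_eq_norm]
    have h1 := hf n z (hsub y hy hz)
    have h2 := hf n y (hsub y hy (mem_ball_self hr2))
    have h3 := norm_sub_le (f (n + 1) z - f n z) (f (n + 1) y - f n y)
    simp only [Pi.sub_apply]
    linarith
  have hus : Summable fun n => 2 * u n / (r / 2) := (hu.mul_left 2).div_const _
  choose! g' hg' using fun y (hy : y ∈ ball x (r / 2)) =>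
    exists_tendsto_of_norm_succ_sub_le (f := fun n => fderiv ℂ (f n)) hus hder hy
  have hunif := tendstoUniformlyOn_of_norm_succ_sub_le (f := fun n => fderiv ℂ (f n)) hus hder hg'
  refine (hasFDerivAt_of_tendstoUniformlyOn isOpen_ball hunif
    (fun n y _ => (hd n y).hasFDerivAt) (fun y hy => hg y (hsub y hy (mem_ball_self hr2)))
    (mem_ball_self hr2)).differentiableAt.differentiableWithinAt

end UniformLimits

/-! ### Infinite compositions of maps close to the identity. -/

section InfiniteComposition

variable {E : Type*} [NormedAddCommGroup E]

/-- The composition `K 0 ∘ K 1 ∘ ⋯ ∘ K (n - 1)`. -/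
def backwardComp {X : Type*} (K : ℕ → X → X) : ℕ → X → X
  | 0 => id
  | n + 1 => backwardComp K n ∘ K n

/-- The points whose orbit under the sequence `H` is eventually bounded. -/
def boundedOrbits (H : ℕ → E → E) : Set E :=
  {z | ∃ R : ℝ, ∃ N : ℕ, ∀ n ≥ N, ‖nonautComp H n z‖ ≤ R}

theorem nonautComp_backwardComp {X : Type*} {H K : ℕ → X → X} (h : ∀ n y, H n (K n y) = y) (n : ℕ)
    (y : X) : nonautComp H n (backwardComp K n y) = y := by
  induction n generalizing y with
  | zero => rfl
  | succ n ih => simp [nonautComp, backwardComp, ih, h]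

theorem backwardComp_nonautComp {X : Type*} {H K : ℕ → X → X} (h : ∀ n y, K n (H n y) = y) (n : ℕ)
    (y : X) : backwardComp K n (nonautComp H n y) = y := by
  induction n generalizing y with
  | zero => rfl
  | succ n ih => simp [nonautComp, backwardComp, ih, h]

theorem exists_forall_sum_shift_le {s : ℕ → ℝ} (hs : Summable s) (h0 : ∀ n, 0 ≤ s n) {ε : ℝ}
    (hε : 0 < ε) : ∃ N, ∀ n ≥ N, ∀ m, ∑ i ∈ Finset.range m, s (n + i) ≤ ε := by
  obtain ⟨N, hN⟩ := eventually_atTop.1 ((tendsto_sum_nat_add s).eventually_lt_const hε)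
  refine ⟨N, fun n hn m => ?_⟩
  have hsn : Summable fun i => s (i + n) := (summable_nat_add_iff n).2 hs
  simp only [add_comm n]
  exact (hsn.sum_le_tsum _ fun i _ => h0 _).trans (hN n hn).le

theorem summable_shift {s : ℕ → ℝ} (hs : Summable s) (N : ℕ) : Summable fun n => s (N + n) := by
  simpa only [add_comm N] using (summable_nat_add_iff N).2 hs

/-- Uniform closeness to the identity on bounded sets, with summable errors. -/
def SummablyNearId (H : ℕ → E → E) : Prop :=
  ∀ R : ℝ, ∃ s : ℕ → ℝ, Summable s ∧ (∀ n, 0 ≤ s n) ∧ ∀ n y, ‖y‖ ≤ R → ‖H n y - y‖ ≤ s n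

theorem norm_nonautComp_le {H : ℕ → E → E} {s : ℕ → ℝ} {R r : ℝ} {N : ℕ}
    (hH : ∀ n y, ‖y‖ ≤ R → ‖H n y - y‖ ≤ s n)
    (hN : ∀ m, r + ∑ i ∈ Finset.range m, s (N + i) ≤ R) {z : E} (hz : ‖nonautComp H N z‖ ≤ r)
    (m : ℕ) : ‖nonautComp H (N + m) z‖ ≤ r + ∑ i ∈ Finset.range m, s (N + i) := by
  induction m with
  | zero => simpa using hz
  | succ m ih =>
    have h1 := hH (N + m) _ (ih.trans (hN m))
    have h2 := norm_le_norm_add_norm_sub' (H (N + m) (nonautComp H (N + m) z))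
      (nonautComp H (N + m) z)
    rw [Finset.sum_range_succ]
    change ‖H (N + m) (nonautComp H (N + m) z)‖ ≤ _
    linarith

/-- The maps of index at least `N` act first and move `z` only within the ball, so long compositions
are controlled by the fixed map `backwardComp K N`. -/
theorem exists_backwardComp_eq {K : ℕ → E → E} {s : ℕ → ℝ} {R : ℝ} {N : ℕ} (h0 : ∀ n, 0 ≤ s n)
    (hK : ∀ n y, ‖y‖ ≤ R → ‖K n y - y‖ ≤ s n) (m : ℕ) (z : E)
    (hz : ‖z‖ + ∑ i ∈ Finset.range m, s (N + i) ≤ R) :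
    ∃ y, ‖y‖ ≤ R ∧ backwardComp K (N + m) z = backwardComp K N y := by
  induction m generalizing z with
  | zero => exact ⟨z, by simpa using hz, rfl⟩
  | succ m ih =>
    rw [Finset.sum_range_succ] at hz
    have hsum : 0 ≤ ∑ i ∈ Finset.range m, s (N + i) := Finset.sum_nonneg fun i _ => h0 _
    have h1 := hK (N + m) z (by linarith [h0 (N + m)])
    have h2 := norm_le_norm_add_norm_sub' (K (N + m) z) z
    exact ih (K (N + m) z) (by linarith)

/-- Near a point with bounded orbit, the forward compositions have summable increments. -/
theorem exists_isOpen_norm_nonautComp_succ_sub_le {H : ℕ → E → E} (hc : ∀ n, Continuous (H n))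
    (hH : SummablyNearId H) {z : E} (hz : z ∈ boundedOrbits H) :
    ∃ U, IsOpen U ∧ z ∈ U ∧ U ⊆ boundedOrbits H ∧ ∃ N, ∃ u : ℕ → ℝ, Summable u ∧
      ∀ n, ∀ x ∈ U, ‖nonautComp H (N + (n + 1)) x - nonautComp H (N + n) x‖ ≤ u n := by
  obtain ⟨R, N₀, hR⟩ := hz
  -- One unit of room is for the neighbourhood of `z`, the other for the tail of the increments.
  obtain ⟨s, hs, h0, hsH⟩ := hH (R + 2)
  obtain ⟨N₁, hN₁⟩ := exists_forall_sum_shift_le hs h0 one_pos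
  set N := max N₀ N₁
  have hN := hN₁ N (le_max_right _ _)
  have hcont : ∀ n, Continuous (nonautComp H n) := fun n => by
    induction n with
    | zero => exact continuous_id
    | succ n ih => exact (hc n).comp ih
  have hle : ∀ x, ‖nonautComp H N x‖ < R + 1 → ∀ m, ‖nonautComp H (N + m) x‖ ≤ R + 2 := by
    intro x hx m
    have := norm_nonautComp_le hsH (fun m => by linarith [hN m]) hx.le m
    linarith [hN m]
  refine ⟨{x | ‖nonautComp H N x‖ < R + 1}, isOpen_lt (hcont N).norm continuous_const, ?_, ?_,
    N, fun n => s (N + n), summable_shift hs N, fun n x hx => hsH _ _ (hle x hx n)⟩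
  · exact (hR N (le_max_left _ _)).trans_lt (by linarith)
  · intro x hx
    refine ⟨R + 2, N, fun n hn => ?_⟩
    obtain ⟨m, rfl⟩ := Nat.exists_eq_add_of_le hn
    exact hle x hx m

variable [NormedSpace ℂ E]

theorem Differentiable.nonautComp {H : ℕ → E → E} (hd : ∀ n, Differentiable ℂ (H n)) (n : ℕ) :
    Differentiable ℂ (nonautComp H n) := by
  induction n with
  | zero => exact differentiable_id
  | succ n ih => exact (hd n).comp ih

theorem Differentiable.backwardComp {K : ℕ → E → E} (hd : ∀ n, Differentiable ℂ (K n)) (n : ℕ) :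
    Differentiable ℂ (backwardComp K n) := by
  induction n with
  | zero => exact differentiable_id
  | succ n ih => exact ih.comp (hd n)

/-- On every ball the backward compositions have summable increments. -/
theorem exists_norm_backwardComp_succ_sub_le [ProperSpace E] {K : ℕ → E → E}
    (hd : ∀ n, Differentiable ℂ (K n)) (hK : SummablyNearId K) (R : ℝ) :
    ∃ N, ∃ u : ℕ → ℝ, Summable u ∧ ∀ n, ∀ x ∈ Metric.ball (0 : E) R,
      ‖backwardComp K (N + (n + 1)) x - backwardComp K (N + n) x‖ ≤ u n := by
  obtain ⟨s, hs, h0, hsK⟩ := hK (R + 2)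
  obtain ⟨N, hN⟩ := exists_forall_sum_shift_le hs h0 (half_pos one_pos)
  have hN := hN N le_rfl
  obtain ⟨M, hM⟩ := (isCompact_closedBall (0 : E) (R + 2)).exists_bound_of_continuousOn
    (Differentiable.backwardComp hd N).continuous.continuousOn
  have hbound : ∀ m, ∀ x : E, ‖x‖ ≤ R + 1 → ‖backwardComp K (N + m) x‖ ≤ M := by
    intro m x hx
    obtain ⟨y, hy, hxy⟩ := exists_backwardComp_eq h0 hsK m x (by linarith [hN m])
    rw [hxy]
    exact hM y (by simpa using hy)
  refine ⟨N, fun n => 2 * M / 1 * s (N + n), (summable_shift hs N).mul_left _, fun n x hx => ?_⟩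
  rw [mem_ball_zero_iff] at hx
  have hball : ∀ y ∈ Metric.ball x 1, ‖y‖ ≤ R + 1 := fun y hy => by
    rw [mem_ball_iff_norm] at hy
    have := norm_le_norm_add_norm_sub' y x
    linarith
  have hx1 : x ∈ Metric.ball x 1 := Metric.mem_ball_self one_pos
  have hMnn : 0 ≤ M := (norm_nonneg _).trans (hbound n x (hball x hx1))
  have hmove := hsK (N + n) x (by linarith)
  have hsmall : s (N + n) ≤ 1 / 2 := by
    have h1 := hN (n + 1)
    rw [Finset.sum_range_succ] at h1
    linarith [Finset.sum_nonneg fun i (_ : i ∈ Finset.range n) => h0 (N + i)]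
  -- Boundedness by `M` on the unit ball about `x` gives a Lipschitz estimate at its centre; the
  -- tail bound `1 / 2` keeps `K (N + n) x` in that ball.
  have hlip := Complex.dist_le_div_mul_dist_of_mapsTo_ball (f := backwardComp K (N + n))
    (c := x) (z := K (N + n) x) (R₁ := 1) (R₂ := 2 * M)
    (Differentiable.backwardComp hd _).differentiableOn (fun y hy => by
      rw [Metric.mem_closedBall, dist_eq_norm]
      have h1 := hbound n y (hball y hy)
      have h2 := hbound n x (hball x hx1)
      have h3 := norm_sub_le (backwardComp K (N + n) y) (backwardComp K (N + n) x)
      linarith) (by rw [mem_ball_iff_norm]; linarith)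
  rw [dist_eq_norm, dist_eq_norm] at hlip
  exact hlip.trans (mul_le_mul_of_nonneg_left hmove (by positivity))

/-- An infinite composition of automorphisms tending summably to the identity maps the set of
points with bounded orbit biholomorphically onto the whole space. -/
theorem biholomorphic_boundedOrbits [ProperSpace E] {H K : ℕ → E → E}
    (hHd : ∀ n, Differentiable ℂ (H n)) (hKd : ∀ n, Differentiable ℂ (K n))
    (hHK : ∀ n y, H n (K n y) = y) (hKH : ∀ n y, K n (H n y) = y)
    (hH : SummablyNearId H) (hK : SummablyNearId K) :
    Biholomorphic (boundedOrbits H) (Set.univ : Set E) := by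
  have hfor := fun z (hz : z ∈ boundedOrbits H) =>
    exists_isOpen_norm_nonautComp_succ_sub_le (fun n => (hHd n).continuous) hH hz
  have hback := exists_norm_backwardComp_succ_sub_le hKd hK
  have hshift : ∀ {g : ℕ → E} {y : E} (N : ℕ), Tendsto (fun n => g (N + n)) atTop (𝓝 y) →
      Tendsto g atTop (𝓝 y) := fun N h => by
    simp only [add_comm N] at h
    exact (tendsto_add_atTop_iff_nat N).1 h
  have hunshift : ∀ {g : ℕ → E} {y : E} (N : ℕ), Tendsto g atTop (𝓝 y) →
      Tendsto (fun n => g (N + n)) atTop (𝓝 y) := fun N h => by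
    simp only [add_comm N]
    exact (tendsto_add_atTop_iff_nat N).2 h
  have hφex : ∀ z ∈ boundedOrbits H, ∃ y, Tendsto (fun n => nonautComp H n z) atTop (𝓝 y) := by
    intro z hz
    obtain ⟨U, -, hzU, -, N, u, hu, hle⟩ := hfor z hz
    obtain ⟨y, hy⟩ := exists_tendsto_of_norm_succ_sub_le
      (f := fun n => nonautComp H (N + n)) hu hle hzU
    exact ⟨y, hshift N hy⟩
  have hψex : ∀ w : E, ∃ y, Tendsto (fun n => backwardComp K n w) atTop (𝓝 y) := by
    intro w
    obtain ⟨N, u, hu, hle⟩ := hback (‖w‖ + 1)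
    obtain ⟨y, hy⟩ := exists_tendsto_of_norm_succ_sub_le
      (f := fun n => backwardComp K (N + n)) hu hle (x := w) (by simp)
    exact ⟨y, hshift N hy⟩
  choose! φ hφ using hφex
  choose ψ hψ using hψex
  have hopen : IsOpen (boundedOrbits H) := isOpen_iff_forall_mem_open.2 fun z hz => by
    obtain ⟨U, hU, hzU, hsub, -⟩ := hfor z hz
    exact ⟨U, hsub, hU, hzU⟩
  have hφd : ∀ z ∈ boundedOrbits H, DifferentiableAt ℂ φ z := by
    intro z hz
    obtain ⟨U, hU, hzU, hsub, N, u, hu, hle⟩ := hfor z hz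
    exact (differentiableOn_of_norm_succ_sub_le (f := fun n => nonautComp H (N + n)) hU hu
      (fun n => Differentiable.nonautComp hHd _) hle
      fun x hx => hunshift N (hφ x (hsub hx))).differentiableAt (hU.mem_nhds hzU)
  have hψd : ∀ w, DifferentiableAt ℂ ψ w := by
    intro w
    obtain ⟨N, u, hu, hle⟩ := hback (‖w‖ + 1)
    exact (differentiableOn_of_norm_succ_sub_le (f := fun n => backwardComp K (N + n))
      Metric.isOpen_ball hu (fun n => Differentiable.backwardComp hKd _) hle
      fun x _ => hunshift N (hψ x)).differentiableAt (Metric.isOpen_ball.mem_nhds (by simp))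
  have hmaps : ∀ w, ψ w ∈ boundedOrbits H := by
    intro w
    obtain ⟨s, hs, h0, hsK⟩ := hK (‖w‖ + 1)
    obtain ⟨N, hN⟩ := exists_forall_sum_shift_le hs h0 one_pos
    refine ⟨‖w‖ + 1, N, fun m hm => ?_⟩
    have hlim := (((Differentiable.nonautComp hHd m).continuous.tendsto _).comp
      (hunshift m (hψ w))).norm
    -- The first `m` forward maps cancel the outer `m` backward ones, leaving a point of the ball of
    -- radius `‖w‖ + 1`.
    refine le_of_tendsto' hlim fun j => ?_
    obtain ⟨y, hy, hwy⟩ := exists_backwardComp_eq h0 hsK j w (by linarith [hN m hm j])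
    simp only [Function.comp_apply, hwy, nonautComp_backwardComp hHK]
    exact hy
  refine ⟨hopen, isOpen_univ, φ, ψ, fun z hz => (hφd z hz).differentiableWithinAt,
    fun w _ => (hψd w).differentiableWithinAt, Set.mapsTo_univ _ _, fun w _ => hmaps w, ?_, ?_⟩
  · intro z hz
    obtain ⟨N, u, hu, hle⟩ := hback (‖φ z‖ + 1)
    have hnhds : Metric.ball (0 : E) (‖φ z‖ + 1) ∈ 𝓝 (φ z) :=
      Metric.isOpen_ball.mem_nhds (by simp)
    -- Local uniformity allows the limit in both the map and its argument, while the finite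
    -- compositions cancel exactly.
    have hunif := tendstoUniformlyOn_of_norm_succ_sub_le
      (f := fun n => backwardComp K (N + n)) hu hle fun x _ => hunshift N (hψ x)
    have h := hunif.tendsto_comp (hψd _).continuousAt.continuousWithinAt
      (x := φ z) (g := fun n => nonautComp H (N + n) z)
      (by rw [nhdsWithin_eq_nhds.2 hnhds]; exact hunshift N (hφ z hz))
    simp only [backwardComp_nonautComp hKH] at h
    exact tendsto_nhds_unique h tendsto_const_nhds
  · intro w _
    obtain ⟨U, hU, hzU, hsub, N, u, hu, hle⟩ := hfor _ (hmaps w)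
    have hunif := tendstoUniformlyOn_of_norm_succ_sub_le
      (f := fun n => nonautComp H (N + n)) hu hle fun x hx => hunshift N (hφ x (hsub hx))
    have h := hunif.tendsto_comp (hφd _ (hmaps w)).continuousAt.continuousWithinAt
      (x := ψ w) (g := fun n => backwardComp K (N + n) w)
      (by rw [hU.nhdsWithin_eq hzU]; exact hunshift N (hψ w))
    simp only [nonautComp_backwardComp hHK] at h
    exact tendsto_nhds_unique h tendsto_const_nhds

end InfiniteComposition

/-! ### Shears conjugated by a triangular map. -/

section TriangularMaps

/-- The triangular map `(y₁, y₂) ↦ (A y₁ + c y₂², B y₂)`. -/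
def triMap (A B c : ℂ) (y : ℂ × ℂ) : ℂ × ℂ := (A * y.1 + c * y.2 ^ 2, B * y.2)

/-- The inverse of `triMap A B c` for nonzero `A` and `B`. -/
noncomputable def triInv (A B c : ℂ) (x : ℂ × ℂ) : ℂ × ℂ :=
  ((x.1 - c * (x.2 / B) ^ 2) / A, x.2 / B)

/-- The shear `(w₁, w₂) ↦ (w₁, w₂ + s w₁ᵏ)`. -/
def powShear (k : ℕ) (s : ℂ) (w : ℂ × ℂ) : ℂ × ℂ := (w.1, w.2 + s * w.1 ^ k)

/-- The shear `powShear k s` conjugated by `triMap A B c`. -/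
noncomputable def conjShear (A B c : ℂ) (k : ℕ) (s : ℂ) (y : ℂ × ℂ) : ℂ × ℂ :=
  triInv A B c (powShear k s (triMap A B c y))

variable {A B c : ℂ} {k : ℕ}

theorem triMap_triInv (hA : A ≠ 0) (hB : B ≠ 0) (x : ℂ × ℂ) :
    triMap A B c (triInv A B c x) = x := by
  ext
  · simp only [triMap, triInv]
    field_simp
    ring
  · simp only [triMap, triInv]
    field_simp

theorem triInv_triMap (hA : A ≠ 0) (hB : B ≠ 0) (y : ℂ × ℂ) :
    triInv A B c (triMap A B c y) = y := by
  ext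
  · simp only [triMap, triInv]
    field_simp
    ring
  · simp only [triMap, triInv]
    field_simp

theorem triMap_triMap (A B c a b e : ℂ) (y : ℂ × ℂ) :
    triMap a b e (triMap A B c y) = triMap (a * A) (b * B) (a * c + e * B ^ 2) y := by
  ext <;> simp only [triMap] <;> ring

theorem conjShear_conjShear_neg (hA : A ≠ 0) (hB : B ≠ 0) (s : ℂ) (y : ℂ × ℂ) :
    conjShear A B c k s (conjShear A B c k (-s) y) = y := by
  have h : ∀ w, powShear k s (powShear k (-s) w) = w := fun w => by
    ext <;> simp [powShear]
  simp only [conjShear, triMap_triInv hA hB, h, triInv_triMap hA hB]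

theorem differentiable_conjShear (A B c : ℂ) (k : ℕ) (s : ℂ) :
    Differentiable ℂ (conjShear A B c k s) := by
  unfold conjShear triInv powShear triMap
  simp only [div_eq_mul_inv]
  fun_prop

theorem conjShear_snd_sub (hB : B ≠ 0) (s : ℂ) (y : ℂ × ℂ) :
    (conjShear A B c k s y).2 - y.2 = s * (triMap A B c y).1 ^ k / B := by
  simp only [conjShear, triInv, powShear, triMap]
  field_simp
  ring

/-- The shear fixes the first coordinate, so `A y₁ + c y₂²` is invariant: the change of `y₁`
compensates that of `c y₂²`. -/
theorem conjShear_fst_sub (hA : A ≠ 0) (s : ℂ) (y : ℂ × ℂ) :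
    (conjShear A B c k s y).1 - y.1 = -(c / A * ((conjShear A B c k s y).2 - y.2) *
      (2 * y.2 + ((conjShear A B c k s y).2 - y.2))) := by
  simp only [conjShear, triInv, powShear, triMap]
  field_simp
  ring

theorem norm_triMap_le (A B c : ℂ) (y : ℂ × ℂ) {r M R : ℝ} (hA : ‖A‖ ≤ r) (hB : ‖B‖ ≤ r)
    (hc : ‖c‖ ≤ M * r) (hM : 0 ≤ M) (hy : ‖y‖ ≤ R) : ‖triMap A B c y‖ ≤ (R + M * R ^ 2) * r := by
  have hr : 0 ≤ r := (norm_nonneg _).trans hA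
  have hR : 0 ≤ R := (norm_nonneg _).trans hy
  have h1 : ‖y.1‖ ≤ R := (norm_fst_le y).trans hy
  have h2 : ‖y.2‖ ≤ R := (norm_snd_le y).trans hy
  refine norm_prod_le_iff.2 ⟨?_, ?_⟩
  · calc ‖A * y.1 + c * y.2 ^ 2‖ ≤ ‖A‖ * ‖y.1‖ + ‖c‖ * ‖y.2‖ ^ 2 := by
          refine (norm_add_le _ _).trans_eq ?_
          rw [norm_mul, norm_mul, norm_pow]
      _ ≤ r * R + M * r * R ^ 2 := by gcongr
      _ = _ := by ring
  · calc ‖B * y.2‖ = ‖B‖ * ‖y.2‖ := norm_mul _ _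
      _ ≤ r * R := by gcongr
      _ ≤ (R + M * R ^ 2) * r := by nlinarith [mul_nonneg (mul_nonneg hM (sq_nonneg R)) hr]

/-- The bound is on the triangular image, not on `y`, so it applies to decaying orbits before `y` is
known to be bounded. -/
theorem norm_conjShear_snd_sub_le {b S W D : ℝ} {n : ℕ} (hb : 0 < b) (hB : b ^ n ≤ ‖B‖) {s : ℂ}
    (hs : ‖s‖ ≤ S) {y : ℂ × ℂ} (hy : ‖(triMap A B c y).1‖ ≤ W * D ^ n) :
    ‖(conjShear A B c k s y).2 - y.2‖ ≤ S * W ^ k * (D ^ k / b) ^ n := by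
  have hB0 : 0 < ‖B‖ := (pow_pos hb n).trans_le hB
  have hS : 0 ≤ S := (norm_nonneg _).trans hs
  rw [conjShear_snd_sub (norm_pos_iff.1 hB0), norm_div, norm_mul, norm_pow]
  calc ‖s‖ * ‖(triMap A B c y).1‖ ^ k / ‖B‖ ≤ S * (W * D ^ n) ^ k / b ^ n := by
        have : 0 ≤ W * D ^ n := (norm_nonneg _).trans hy
        gcongr
    _ = _ := by rw [mul_pow, div_pow, ← pow_mul, ← pow_mul, mul_comm n k]; ring

/-- The divisions by `A` and `B` are estimated together: only the product `‖A‖ * ‖B‖` is large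
enough compared with `‖c‖`. -/
theorem norm_conjShear_fst_sub_le {b S W D M : ℝ} {n : ℕ} (hb : 0 < b) (hA : A ≠ 0) (hB : B ≠ 0)
    (hc : ‖c‖ * b ^ n ≤ M * (‖A‖ * ‖B‖)) {s : ℂ} (hs : ‖s‖ ≤ S) {y : ℂ × ℂ}
    (hy : ‖(triMap A B c y).1‖ ≤ W * D ^ n) :
    ‖(conjShear A B c k s y).1 - y.1‖ ≤ M * (S * W ^ k * (D ^ k / b) ^ n) *
      (2 * ‖y.2‖ + ‖(conjShear A B c k s y).2 - y.2‖) := by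
  have hA0 : 0 < ‖A‖ := norm_pos_iff.2 hA
  have hB0 : 0 < ‖B‖ := norm_pos_iff.2 hB
  have hbn : 0 < b ^ n := pow_pos hb n
  have hS : 0 ≤ S := (norm_nonneg _).trans hs
  have hW : 0 ≤ W * D ^ n := (norm_nonneg _).trans hy
  have hq : ‖c‖ / (‖A‖ * ‖B‖) ≤ M / b ^ n := by
    rw [div_le_div_iff₀ (by positivity) hbn]
    exact hc
  rw [conjShear_fst_sub hA, norm_neg, norm_mul]
  refine mul_le_mul ?_ ?_ (norm_nonneg _) ?_
  · rw [conjShear_snd_sub hB, norm_mul, norm_div, norm_div, norm_mul, norm_pow]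
    calc ‖c‖ / ‖A‖ * (‖s‖ * ‖(triMap A B c y).1‖ ^ k / ‖B‖)
        = ‖c‖ / (‖A‖ * ‖B‖) * (‖s‖ * ‖(triMap A B c y).1‖ ^ k) := by field_simp
      _ ≤ M / b ^ n * (S * (W * D ^ n) ^ k) := by
        have : 0 ≤ M / b ^ n := le_trans (by positivity) hq
        gcongr
      _ = _ := by rw [mul_pow, div_pow, ← pow_mul, ← pow_mul, mul_comm n k]; ring
  · refine (norm_add_le _ _).trans ?_
    simp
  · have hM : 0 ≤ M := by
      have : 0 ≤ M / b ^ n := le_trans (by positivity) hq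
      by_contra! h
      exact absurd (div_neg_of_neg_of_pos h hbn) (not_lt.2 this)
    have : 0 ≤ W ^ k * (D ^ k / b) ^ n := by
      have e : W ^ k * (D ^ k / b) ^ n = (W * D ^ n) ^ k / b ^ n := by
        rw [mul_pow, div_pow, ← pow_mul, ← pow_mul, mul_comm n k]; ring
      rw [e]; positivity
    rw [mul_assoc S]
    positivity

end TriangularMaps

/-! ### Compositions of triangular maps and their coefficients. -/

section TriangularCocycle

/-- The coefficient of `y₂²` in the composition of the triangular maps `triMap (a i) (b i) (e i)`,
`i < n`. -/
def quadCoeff (a b e : ℕ → ℂ) : ℕ → ℂ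
  | 0 => 0
  | n + 1 => a n * quadCoeff a b e n + e n * (∏ i ∈ Finset.range n, b i) ^ 2

/-- The composition of the triangular maps `triMap (a i) (b i) (e i)`, `i < n`. -/
noncomputable def triComp (a b e : ℕ → ℂ) (n : ℕ) : ℂ × ℂ → ℂ × ℂ :=
  triMap (∏ i ∈ Finset.range n, a i) (∏ i ∈ Finset.range n, b i) (quadCoeff a b e n)

/-- The shear `powShear k (s n)` conjugated by `triComp a b e n`. -/
noncomputable def cocycleShear (a b e : ℕ → ℂ) (k : ℕ) (s : ℕ → ℂ) (n : ℕ) : ℂ × ℂ → ℂ × ℂ :=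
  conjShear (∏ i ∈ Finset.range n, a i) (∏ i ∈ Finset.range n, b i) (quadCoeff a b e n) k (s n)

variable {a b e : ℕ → ℂ} {k : ℕ} {s : ℕ → ℂ}

theorem nonautComp_eq_triComp {f : ℕ → ℂ × ℂ → ℂ × ℂ} (ha : ∀ n, a n ≠ 0) (hb : ∀ n, b n ≠ 0)
    (hf : ∀ n z, f n z = triMap (a n) (b n) (e n) (powShear k (s n) z)) (n : ℕ) (z : ℂ × ℂ) :
    nonautComp f n z = triComp a b e n (nonautComp (cocycleShear a b e k s) n z) := by
  induction n with
  | zero => simp [nonautComp, triComp, triMap, quadCoeff]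
  | succ n ih =>
    change f n (nonautComp f n z) =
      triComp a b e (n + 1) (cocycleShear a b e k s n (nonautComp (cocycleShear a b e k s) n z))
    rw [ih, hf]
    simp only [triComp, cocycleShear, conjShear, quadCoeff, Finset.prod_range_succ]
    rw [mul_comm _ (a n), mul_comm _ (b n), ← triMap_triMap,
      triMap_triInv (Finset.prod_ne_zero_iff.2 fun i _ => ha i)
        (Finset.prod_ne_zero_iff.2 fun i _ => hb i)]

theorem norm_prod_range_le {a : ℕ → ℂ} {r : ℝ} (h : ∀ n, ‖a n‖ ≤ r) (n : ℕ) :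
    ‖∏ i ∈ Finset.range n, a i‖ ≤ r ^ n := by
  rw [norm_prod]
  simpa using Finset.prod_le_prod (s := Finset.range n) (fun i _ => norm_nonneg (a i))
    fun i _ => h i

theorem pow_le_norm_prod_range {a : ℕ → ℂ} {r : ℝ} (hr : 0 ≤ r) (h : ∀ n, r ≤ ‖a n‖) (n : ℕ) :
    r ^ n ≤ ‖∏ i ∈ Finset.range n, a i‖ := by
  rw [norm_prod]
  simpa using Finset.prod_le_prod (s := Finset.range n) (fun _ _ => hr) fun i _ => h i

theorem norm_quadCoeff_le {r : ℝ} (hr0 : 0 < r) (hr1 : r < 1) (ha : ∀ n, ‖a n‖ ≤ r)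
    (hb : ∀ n, ‖b n‖ ≤ r) (he : ∀ n, ‖e n‖ ≤ 1) (n : ℕ) :
    ‖quadCoeff a b e n‖ ≤ 1 / (r * (1 - r)) * r ^ n := by
  have h1r : 0 < 1 - r := by linarith
  -- The factor `1 - r ^ n` makes the bound satisfy the recursion with equality.
  suffices h : ‖quadCoeff a b e n‖ ≤ 1 / (r * (1 - r)) * r ^ n * (1 - r ^ n) by
    refine h.trans (mul_le_of_le_one_right (by positivity) ?_)
    linarith [pow_pos hr0 n]
  induction n with
  | zero => simp [quadCoeff]
  | succ n ih =>
    calc ‖a n * quadCoeff a b e n + e n * (∏ i ∈ Finset.range n, b i) ^ 2‖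
        ≤ ‖a n‖ * ‖quadCoeff a b e n‖ + ‖e n‖ * ‖∏ i ∈ Finset.range n, b i‖ ^ 2 := by
          refine (norm_add_le _ _).trans_eq ?_
          rw [norm_mul, norm_mul, norm_pow]
      _ ≤ r * (1 / (r * (1 - r)) * r ^ n * (1 - r ^ n)) + 1 * (r ^ n) ^ 2 := by
          gcongr
          · exact ha n
          · exact he n
          · exact norm_prod_range_le hb n
      _ = _ := by
          field_simp
          ring

end TriangularCocycle

/-! ### Summability of the conjugated shears and the basin. -/

section Basin

/-- Bounds on the coefficients of a sequence of triangular maps, `r` and `q` bounding the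
linear parts from above and below, with constant Jacobian modulus `r * q`. -/
structure TriBounds (a b e : ℕ → ℂ) (r q : ℝ) : Prop where
  q_pos : 0 < q
  r_pos : 0 < r
  r_lt_one : r < 1
  norm_a_le : ∀ n, ‖a n‖ ≤ r
  norm_b_le : ∀ n, ‖b n‖ ≤ r
  le_norm_b : ∀ n, q ≤ ‖b n‖
  norm_mul : ∀ n, ‖a n‖ * ‖b n‖ = r * q
  norm_e_le : ∀ n, ‖e n‖ ≤ 1

namespace TriBounds

variable {a b e : ℕ → ℂ} {r q : ℝ} {k : ℕ} {s : ℕ → ℂ} {S D : ℝ}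

theorem a_ne_zero (h : TriBounds a b e r q) (n : ℕ) : a n ≠ 0 := fun h0 => by
  have h1 := h.norm_mul n
  rw [h0, norm_zero, zero_mul] at h1
  exact (mul_pos h.r_pos h.q_pos).ne h1

theorem b_ne_zero (h : TriBounds a b e r q) (n : ℕ) : b n ≠ 0 :=
  norm_pos_iff.1 (h.q_pos.trans_le (h.le_norm_b n))

theorem prod_a_ne_zero (h : TriBounds a b e r q) (n : ℕ) : ∏ i ∈ Finset.range n, a i ≠ 0 :=
  Finset.prod_ne_zero_iff.2 fun i _ => h.a_ne_zero i

theorem prod_b_ne_zero (h : TriBounds a b e r q) (n : ℕ) : ∏ i ∈ Finset.range n, b i ≠ 0 :=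
  Finset.prod_ne_zero_iff.2 fun i _ => h.b_ne_zero i

theorem const_nonneg (h : TriBounds a b e r q) : 0 ≤ 1 / (r * (1 - r)) := by
  have h1 : 0 < 1 - r := by linarith [h.r_lt_one]
  have h2 := h.r_pos
  positivity

theorem norm_quadCoeff_mul_le (h : TriBounds a b e r q) (n : ℕ) :
    ‖quadCoeff a b e n‖ * q ^ n ≤ 1 / (r * (1 - r)) *
      (‖∏ i ∈ Finset.range n, a i‖ * ‖∏ i ∈ Finset.range n, b i‖) := by
  have hprod : ‖∏ i ∈ Finset.range n, a i‖ * ‖∏ i ∈ Finset.range n, b i‖ = r ^ n * q ^ n := by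
    rw [norm_prod, norm_prod, ← Finset.prod_mul_distrib, Finset.prod_congr rfl
      fun i _ => h.norm_mul i, Finset.prod_const, Finset.card_range, mul_pow]
  rw [hprod, ← mul_assoc]
  exact mul_le_mul_of_nonneg_right (norm_quadCoeff_le h.r_pos h.r_lt_one h.norm_a_le h.norm_b_le
    h.norm_e_le n) (pow_pos h.q_pos n).le

theorem norm_triComp_le (h : TriBounds a b e r q) (n : ℕ) {y : ℂ × ℂ} {R : ℝ} (hy : ‖y‖ ≤ R) :
    ‖triComp a b e n y‖ ≤ (R + 1 / (r * (1 - r)) * R ^ 2) * r ^ n :=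
  norm_triMap_le _ _ _ _ (norm_prod_range_le h.norm_a_le n) (norm_prod_range_le h.norm_b_le n)
    (norm_quadCoeff_le h.r_pos h.r_lt_one h.norm_a_le h.norm_b_le h.norm_e_le n) h.const_nonneg hy

theorem norm_snd_sub_le (h : TriBounds a b e r q) (hs : ∀ n, ‖s n‖ ≤ S) {n : ℕ} {y : ℂ × ℂ}
    {W : ℝ} (hy : ‖triComp a b e n y‖ ≤ W * D ^ n) :
    ‖(cocycleShear a b e k s n y).2 - y.2‖ ≤ S * W ^ k * (D ^ k / q) ^ n :=
  norm_conjShear_snd_sub_le h.q_pos (pow_le_norm_prod_range h.q_pos.le h.le_norm_b n) (hs n)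
    ((norm_fst_le _).trans hy)

theorem norm_fst_sub_le (h : TriBounds a b e r q) (hs : ∀ n, ‖s n‖ ≤ S) (hD : 0 < D)
    (hDq : D ^ k < q) {n : ℕ} {y : ℂ × ℂ} {W R : ℝ} (hy : ‖triComp a b e n y‖ ≤ W * D ^ n)
    (hR : ‖y.2‖ ≤ R) :
    ‖(cocycleShear a b e k s n y).1 - y.1‖ ≤
      1 / (r * (1 - r)) * (S * W ^ k * (D ^ k / q) ^ n) * (2 * R + S * W ^ k) := by
  have hS : 0 ≤ S := (norm_nonneg _).trans (hs 0)
  have hW : 0 ≤ W := by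
    by_contra! hW
    exact absurd ((norm_nonneg _).trans hy) (not_le.2 (mul_neg_of_neg_of_pos hW (pow_pos hD n)))
  have hq := h.q_pos
  have hM := h.const_nonneg
  have hθ : (D ^ k / q) ^ n ≤ 1 := pow_le_one₀ (by positivity) ((div_le_one hq).2 hDq.le)
  refine (norm_conjShear_fst_sub_le h.q_pos (h.prod_a_ne_zero n) (h.prod_b_ne_zero n)
    (h.norm_quadCoeff_mul_le n) (hs n) ((norm_fst_le _).trans hy)).trans ?_
  refine mul_le_mul_of_nonneg_left ?_ (by positivity)
  refine add_le_add (by linarith) ((h.norm_snd_sub_le hs hy).trans ?_)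
  exact mul_le_of_le_one_right (by positivity) hθ

theorem summable_geometric_bound (h : TriBounds a b e r q) (hD : 0 < D) (hDq : D ^ k < q) (C : ℝ) :
    Summable fun n : ℕ => C * (D ^ k / q) ^ n :=
  (summable_geometric_of_lt_one (div_nonneg (pow_pos hD k).le h.q_pos.le)
    ((div_lt_one h.q_pos).2 hDq)).mul_left C

theorem summablyNearId (h : TriBounds a b e r q) (hs : ∀ n, ‖s n‖ ≤ S) (hrD : r ≤ D)
    (hDq : D ^ k < q) : SummablyNearId (cocycleShear a b e k s) := by
  intro R
  have hD : 0 < D := h.r_pos.trans_le hrD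
  have hS : 0 ≤ S := (norm_nonneg _).trans (hs 0)
  have hM := h.const_nonneg
  have hq := h.q_pos
  have hr := h.r_pos
  set M := 1 / (r * (1 - r))
  set W := |R| + M * |R| ^ 2
  have hW : 0 ≤ W := by positivity
  set C := S * W ^ k + M * (S * W ^ k) * (2 * |R| + S * W ^ k)
  refine ⟨fun n => C * (D ^ k / q) ^ n, h.summable_geometric_bound hD hDq C,
    fun n => by positivity, fun n y hy => ?_⟩
  have hyR : ‖y‖ ≤ |R| := hy.trans (le_abs_self R)
  have hT : ‖triComp a b e n y‖ ≤ W * D ^ n :=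
    (h.norm_triComp_le n hyR).trans (by gcongr)
  have h1 := h.norm_fst_sub_le (k := k) hs hD hDq hT ((norm_snd_le y).trans hyR)
  have h2 := h.norm_snd_sub_le (k := k) hs hT
  have hθ : 0 ≤ (D ^ k / q) ^ n := by positivity
  refine norm_prod_le_iff.2 ⟨h1.trans ?_, h2.trans ?_⟩
  · have : 0 ≤ S * W ^ k * (D ^ k / q) ^ n := by positivity
    simp only [C, add_mul]
    linarith
  · have : 0 ≤ M * (S * W ^ k) * (2 * |R| + S * W ^ k) * (D ^ k / q) ^ n := by positivity
    simp only [C, add_mul _ _ ((D ^ k / q) ^ n)]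
    linarith

end TriBounds

theorem exists_forall_norm_le_of_norm_succ_sub_le {F : Type*} [NormedAddCommGroup F] {v : ℕ → F}
    {u : ℕ → ℝ} (hu : Summable u) {N : ℕ} (hv : ∀ n ≥ N, ‖v (n + 1) - v n‖ ≤ u n) :
    ∃ R, ∀ n ≥ N, ‖v n‖ ≤ R := by
  have hc : CauchySeq fun n => v (N + n) := cauchySeq_of_dist_le_of_summable (fun n => u (N + n))
    (fun n => by rw [dist_comm, dist_eq_norm]; exact hv (N + n) (Nat.le_add_right _ _))
    (summable_shift hu N)
  obtain ⟨R, hR⟩ := hc.norm_bddAbove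
  refine ⟨R, fun n hn => ?_⟩
  obtain ⟨m, rfl⟩ := Nat.exists_eq_add_of_le hn
  exact hR ⟨m, rfl⟩

theorem norm_mapF_le {α β : ℂ} (hβ : ‖β‖ ≤ ‖α‖) (z : ℂ × ℂ) :
    ‖mapF α β z‖ ≤ (‖α‖ + ‖z‖) * ‖z‖ := by
  have h1 := norm_fst_le z
  have h2 := norm_snd_le z
  refine norm_prod_le_iff.2 ⟨?_, ?_⟩
  · calc ‖α * z.1 + z.2 ^ 2‖ ≤ ‖α‖ * ‖z.1‖ + ‖z.2‖ ^ 2 := by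
          refine (norm_add_le _ _).trans_eq ?_
          rw [norm_mul, norm_pow]
      _ ≤ ‖α‖ * ‖z‖ + ‖z‖ ^ 2 := by gcongr
      _ = _ := by ring
  · calc ‖β * z.2‖ = ‖β‖ * ‖z.2‖ := norm_mul _ _
      _ ≤ (‖α‖ + ‖z‖) * ‖z‖ := by
        gcongr
        linarith [norm_nonneg z]

theorem norm_mapG_le {α β : ℂ} (hβ : ‖β‖ ≤ ‖α‖) {k : ℕ} (hk : 2 ≤ k) {z : ℂ × ℂ} (hz : ‖z‖ ≤ 1) :
    ‖mapG α β k z‖ ≤ (‖α‖ + ‖z‖) * ‖z‖ := by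
  have h1 := norm_fst_le z
  have h2 := norm_snd_le z
  refine norm_prod_le_iff.2 ⟨?_, ?_⟩
  · calc ‖β * z.1‖ = ‖β‖ * ‖z.1‖ := norm_mul _ _
      _ ≤ (‖α‖ + ‖z‖) * ‖z‖ := by
        gcongr
        linarith [norm_nonneg z]
  · calc ‖α * z.2 + z.1 ^ k‖ ≤ ‖α‖ * ‖z.2‖ + ‖z.1‖ ^ k := by
          refine (norm_add_le _ _).trans_eq ?_
          rw [norm_mul, norm_pow]
      _ ≤ ‖α‖ * ‖z‖ + ‖z‖ ^ k := by gcongr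
      _ ≤ ‖α‖ * ‖z‖ + ‖z‖ ^ 2 := by
          gcongr ‖α‖ * ‖z‖ + ?_
          exact pow_le_pow_of_le_one (norm_nonneg _) hz hk
      _ = _ := by ring

/-- An orbit tending to the origin decays at every rate larger than the contraction rate `r`. -/
theorem exists_norm_nonautComp_le_mul_pow {E : Type*} [NormedAddCommGroup E] {f : ℕ → E → E}
    {r D : ℝ} (hD : 0 < D) (hrD : r < D)
    (hf : ∀ n z, ‖z‖ ≤ 1 → ‖f n z‖ ≤ (r + ‖z‖) * ‖z‖) {z : E} (hz : z ∈ nonautBasin f 0) :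
    ∃ N, ∃ W : ℝ, ∀ n ≥ N, ‖nonautComp f n z‖ ≤ W * D ^ n := by
  have hz0 : Tendsto (fun n => ‖nonautComp f n z‖) atTop (𝓝 0) := by
    simpa using Tendsto.norm (show Tendsto _ _ _ from hz)
  -- Once the norm is at most `D - r`, each step contracts by the factor `D`.
  obtain ⟨N, hN⟩ := eventually_atTop.1
    ((hz0.eventually_le_const one_pos).and (hz0.eventually_le_const (sub_pos.2 hrD)))
  refine ⟨N, ‖nonautComp f N z‖ / D ^ N, fun n hn => ?_⟩
  induction n, hn using Nat.le_induction with
  | base => field_simp; rfl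
  | succ n hn ih =>
    obtain ⟨h1, h2⟩ := hN n hn
    calc ‖f n (nonautComp f n z)‖ ≤ (r + ‖nonautComp f n z‖) * ‖nonautComp f n z‖ := hf n _ h1
      _ ≤ D * (‖nonautComp f N z‖ / D ^ N * D ^ n) := by
        gcongr
        linarith
      _ = _ := by ring

/-- The basin of a sequence of triangular maps composed with shears consists of the points whose
orbit under the conjugated shears is bounded. -/
theorem nonautBasin_eq_boundedOrbits {a b e s : ℕ → ℂ} {r q S D : ℝ} {k : ℕ}
    {f : ℕ → ℂ × ℂ → ℂ × ℂ} (h : TriBounds a b e r q) (hs : ∀ n, ‖s n‖ ≤ S) (hrD : r < D)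
    (hDq : D ^ k < q) (hf : ∀ n z, f n z = triMap (a n) (b n) (e n) (powShear k (s n) z))
    (hfr : ∀ n z, ‖z‖ ≤ 1 → ‖f n z‖ ≤ (r + ‖z‖) * ‖z‖) :
    nonautBasin f 0 = boundedOrbits (cocycleShear a b e k s) := by
  have hD : 0 < D := h.r_pos.trans hrD
  have hcomp := nonautComp_eq_triComp h.a_ne_zero h.b_ne_zero hf
  ext z
  constructor
  · intro hz
    obtain ⟨N, W, hW⟩ := exists_norm_nonautComp_le_mul_pow hD hrD hfr hz
    simp only [hcomp] at hW
    -- The second coordinate comes first: its bound enters the increments of the first coordinate.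
    obtain ⟨R₂, hR₂⟩ := exists_forall_norm_le_of_norm_succ_sub_le
      (v := fun n => (nonautComp (cocycleShear a b e k s) n z).2)
      (h.summable_geometric_bound hD hDq (S * W ^ k))
      (fun n hn => h.norm_snd_sub_le (k := k) hs (hW n hn))
    obtain ⟨R₁, hR₁⟩ := exists_forall_norm_le_of_norm_succ_sub_le
      (v := fun n => (nonautComp (cocycleShear a b e k s) n z).1)
      (((h.summable_geometric_bound hD hDq (S * W ^ k)).mul_left _).mul_right _)
      (fun n hn => h.norm_fst_sub_le (k := k) hs hD hDq (hW n hn) (hR₂ n hn))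
    exact ⟨max R₁ R₂, N, fun n hn => norm_prod_le_iff.2
      ⟨(hR₁ n hn).trans (le_max_left _ _), (hR₂ n hn).trans (le_max_right _ _)⟩⟩
  · rintro ⟨R, N, hR⟩
    have hlim : Tendsto (fun n => (R + 1 / (r * (1 - r)) * R ^ 2) * r ^ n) atTop (𝓝 0) := by
      simpa using (tendsto_pow_atTop_nhds_zero_of_lt_one h.r_pos.le h.r_lt_one).const_mul
        (R + 1 / (r * (1 - r)) * R ^ 2)
    refine squeeze_zero_norm' ?_ hlim
    filter_upwards [eventually_ge_atTop N] with n hn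
    rw [hcomp]
    exact h.norm_triComp_le n (hR n hn)

end Basin

theorem proposition1p2 (α β : ℂ) (k : ℕ) (hk : 2 ≤ k)
    (hβ_lower : ‖α‖ ^ k < ‖β‖) (hβ_upper : ‖β‖ ≤ ‖α‖ ^ (k - 1))
    (f : ℕ → ℂ × ℂ → ℂ × ℂ) (hf : ∀ n, f n = mapF α β ∨ f n = mapG α β k) :
    Biholomorphic (nonautBasin f 0) (Set.univ : Set (ℂ × ℂ)) := by
  have hβ : 0 < ‖β‖ := (by positivity : (0 : ℝ) ≤ ‖α‖ ^ k).trans_lt hβ_lower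
  have hα : 0 < ‖α‖ := by
    rcases (norm_nonneg α).eq_or_lt with h | h
    · rw [← h, zero_pow (by omega)] at hβ_upper
      linarith
    · exact h
  have hα1 : ‖α‖ < 1 := by
    by_contra! h
    exact absurd (hβ_upper.trans (pow_le_pow_right₀ h (Nat.sub_le k 1))) (not_le.2 hβ_lower)
  have hβα : ‖β‖ ≤ ‖α‖ := hβ_upper.trans (pow_le_of_le_one hα.le hα1.le (by omega))
  have hα0 : α ≠ 0 := norm_pos_iff.1 hα
  -- Basin orbits are only shown to decay at rates above `‖α‖`; the strict inequality `‖α‖ ^ k <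
  -- ‖β‖` leaves room for one.
  obtain ⟨D, hαD, hDβ⟩ : ∃ D, ‖α‖ < D ∧ D ^ k < ‖β‖ := by
    have hev := (continuous_pow k).continuousAt.eventually_lt_const hβ_lower
    obtain ⟨D, hD, hDα⟩ := ((hev.filter_mono nhdsWithin_le_nhds).and
      (self_mem_nhdsWithin (s := Set.Ioi ‖α‖))).exists
    exact ⟨D, hDα, hD⟩
  have hdata : ∀ n, ∃ a b e s : ℂ, (∀ z, f n z = triMap a b e (powShear k s z)) ∧
      ‖a‖ ≤ ‖α‖ ∧ ‖b‖ ≤ ‖α‖ ∧ ‖β‖ ≤ ‖b‖ ∧ ‖a‖ * ‖b‖ = ‖α‖ * ‖β‖ ∧ ‖e‖ ≤ 1 ∧ ‖s‖ ≤ ‖α‖⁻¹ := by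
    intro n
    rcases hf n with h | h
    · refine ⟨α, β, 1, 0, fun z => ?_, le_rfl, hβα, le_rfl, rfl, by simp, by simp⟩
      simp [h, mapF, triMap, powShear]
    -- The shear acts before the scaling by `α`, hence the parameter `α⁻¹`.
    · refine ⟨β, α, 0, α⁻¹, fun z => ?_, hβα, le_rfl, hβα, mul_comm _ _, by simp, by simp⟩
      simp [h, mapG, triMap, powShear, mul_add, hα0]
  choose a b e s hfs ha hb hb' hab he hs using hdata
  have hT : TriBounds a b e ‖α‖ ‖β‖ := ⟨hβ, hα, hα1, ha, hb, hb', hab, he⟩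
  have hfr : ∀ n z, ‖z‖ ≤ 1 → ‖f n z‖ ≤ (‖α‖ + ‖z‖) * ‖z‖ := by
    intro n z hz
    rcases hf n with h | h <;> rw [h]
    · exact norm_mapF_le hβα z
    · exact norm_mapG_le hβα hk hz
  rw [nonautBasin_eq_boundedOrbits hT hs hαD hDβ hfs hfr]
  refine biholomorphic_boundedOrbits (K := cocycleShear a b e k (-s))
    (fun n => differentiable_conjShear _ _ _ _ _) (fun n => differentiable_conjShear _ _ _ _ _)
    (fun n y => conjShear_conjShear_neg (hT.prod_a_ne_zero n) (hT.prod_b_ne_zero n) _ y)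
    (fun n y => ?_) (hT.summablyNearId hs hαD.le hDβ)
    (hT.summablyNearId (fun n => by simpa using hs n) hαD.le hDβ)
  have h := conjShear_conjShear_neg (c := quadCoeff a b e n) (k := k) (hT.prod_a_ne_zero n)
    (hT.prod_b_ne_zero n) (-s n) y
  rwa [neg_neg] at h
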